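/- Let $\alpha>0$ and $\beta\ge 0$, and put $\beta_i=\beta i+i(i-1)$ for $i\in\mathbb{Z}_+=\{0,1,2,\dots\}$. Let $\pi=\mathrm{PBD}(\alpha;0,\beta,1)$ be the equilibrium distribution of the birth-death process on $\mathbb{Z}_+$ with birth rates $\alpha$ and death rates $\beta_i$: for $\beta>0$, $$\pi_n=\frac{\alpha^n}{\prod_{i=1}^n\beta_i}\Big(1+\sum_{j=1}^\infty\frac{\alpha^j}{\prod_{i=1}^j\beta_i}\Big)^{-1},\qquad n\ge 0,$$ and for $\beta=0$ (where state $0$ is transient) $\pi_0=0$ and, for $n\ge1$, $$\pi_n=\frac{\alpha^{n-1}}{\prod_{i=2}^n\beta_i}\Big(1+\sum_{j=2}^\infty\frac{\alpha^{j-1}}{\prod_{i=2}^j\beta_i}\Big)^{-1}.$$ Then $\pi$ is a probability distribution with finite mean. Let $\mathcal F$ be the set of functions $f:\mathbb{Z}_+\to\mathbb{R}$ with $|f(x)-f(y)|\le|x-y|$ for all $x,y$. Every $f\in\mathcal F$ is $\pi$-integrable; write $\pi(f)=\sum_{k\ge0} f(k)\pi_k$. For every $f\in\mathcal F$ there is exactly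 one $g_f:\mathbb{Z}_+\to\mathbb{R}$ with $g_f(0)=g_f(1)$ and $$\alpha\, g_f(i+1)-[\beta i+i(i-1)]\,g_f(i)=f(i)-\pi(f)\qquad\text{for all } i\in\mathbb{Z}_+ .$$ With $\|g\|=\sup_{i\in\mathbb{Z}_+}|g(i)|$, $\Delta g(i)=g(i+1)-g(i)$ and $\Delta^2g=\Delta(\Delta g)$, these solutions satisfy $$\sup_{f\in\mathcal F}\|g_f\|=\frac1\alpha\sum_{k=1}^\infty k\pi_k\le\min\left\{\frac{1}{\beta+\frac{2\alpha}{\alpha+2\beta+2}},\ \frac{\sqrt{\alpha+(1-\beta)^2/4}+(1-\beta)/2}{\alpha}\right\},$$ $$\sup_{f\in\mathcal F}\|\Delta g_f\|\le\min\left\{\frac1{\beta+1}+\frac{\alpha+2}{\alpha(\alpha+2)+2\beta(\alpha+\beta+1)},\ \frac1{\sqrt\alpha}+\frac1\alpha\right\},$$ $$\sup_{f\in\mathcal F}\|\Delta^2g_f\|\le\frac2\alpha+\frac1{\alpha+\beta(1+\beta+\alpha/2)}\le\frac3\alpha .$$ -/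

import Mathlib

open scoped ENNReal

noncomputable section

namespace PBD

/-- Death rate `β i + i (i - 1)` of the birth-death process in state `i`; the birth rate is the
constant `α`. -/
def deathRate (β : ℝ) (i : ℕ) : ℝ := β * i + i * ((i : ℝ) - 1)

/-- Smallest recurrent state of the birth-death process with birth rate `α > 0` and death rates
`deathRate β`. It is `0` for `β > 0`. For `β = 0` the death rate in state `1` vanishes, the state `0`
is transient, and the process lives on `{1, 2, …}`. -/
def firstState (β : ℝ) : ℕ := if β = 0 then 1 else 0

/-- Unnormalised equilibrium weights: `∏_{i=r}^{n-1} α / ∏_{i=r+1}^{n} β_i` for `n ≥ r`, where `r` is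
the smallest recurrent state (so `r = 0` for `β > 0`), and `0` for `n < r`. -/
def weight (α β : ℝ) (n : ℕ) : ℝ :=
  if n < firstState β then 0
  else (∏ _i ∈ Finset.Ico (firstState β) n, α) /
    ∏ i ∈ Finset.Ioc (firstState β) n, deathRate β i

/-- The probability function of `PBD(α; 0, β, 1)`. -/
def prob (α β : ℝ) (n : ℕ) : ℝ := weight α β n / ∑' j, weight α β j

/-- `PBD(α; 0, β, 1)(f)`, the integral of `f` against `PBD(α; 0, β, 1)`. -/
def integral (α β : ℝ) (f : ℕ → ℝ) : ℝ := ∑' k, f k * prob α β k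

/-- The test functions of the Wasserstein distance: `|f x - f y| ≤ |x - y|` on `{0, 1, 2, …}`. -/
def testFunctions : Set (ℕ → ℝ) := {f | ∀ x y : ℕ, |f x - f y| ≤ |(x : ℝ) - y|}

/-- `g` solves the Stein equation of `PBD(α; 0, β, 1)` for `f`, with the convention `g 0 = g 1`. -/
def IsSteinSolution (α β : ℝ) (f g : ℕ → ℝ) : Prop :=
  g 0 = g 1 ∧ ∀ i : ℕ, α * g (i + 1) - deathRate β i * g i = f i - integral α β f

/-- Supremum norm, with value `∞` for unbounded functions. -/
def supNorm (g : ℕ → ℝ) : ℝ≥0∞ := ⨆ i, ‖g i‖ₑ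

/-- For `β > 0` the weights are the usual `∏_{i=0}^{n-1} α / ∏_{i=1}^{n} β_i`. -/
theorem weight_of_pos (α : ℝ) {β : ℝ} (hβ : 0 < β) (n : ℕ) :
    weight α β n = α ^ n / ∏ i ∈ Finset.Icc 1 n, deathRate β i := by
  have h : Finset.Ioc 0 n = Finset.Icc 1 n := by ext; simp [Nat.succ_le_iff]
  simp [weight, firstState, hβ.ne', h]

/-- The detailed balance equations `α π_k = β_{k+1} π_{k+1}`, also for `β = 0`. -/
theorem balance (α : ℝ) {β : ℝ} (hβ : 0 ≤ β) (k : ℕ) :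
    α * prob α β k = deathRate β (k + 1) * prob α β (k + 1) := by
  have key : α * weight α β k = deathRate β (k + 1) * weight α β (k + 1) := by
    by_cases hk : k < firstState β
    · have h0 : β = 0 := by
        by_contra h
        simp [firstState, h] at hk
      have hk0 : k = 0 := by simpa [firstState, h0] using hk
      subst hk0
      simp [weight, deathRate, h0, firstState]
    · have hk' : firstState β ≤ k := not_lt.mp hk
      have hd : deathRate β (k + 1) ≠ 0 := by
        rcases eq_or_ne β 0 with h0 | h0
        · have : 1 ≤ k := by simpa [firstState, h0] using hk'
          have h1 : (0 : ℝ) < k := by exact_mod_cast this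
          have : 0 < deathRate β (k + 1) := by
            simp only [deathRate, h0]; push_cast; nlinarith
          exact this.ne'
        · have hb : 0 < β := lt_of_le_of_ne hβ (Ne.symm h0)
          have h1 : (0 : ℝ) ≤ k := Nat.cast_nonneg k
          have : 0 < deathRate β (k + 1) := by
            simp only [deathRate]; push_cast; nlinarith [mul_nonneg hβ h1]
          exact this.ne'
      have hk2 : ¬ k + 1 < firstState β := by omega
      simp only [weight, hk, hk2, if_false]
      rw [Finset.prod_Ico_succ_top hk', ← Finset.insert_Ioc_right_eq_Ioc_add_one hk',
        Finset.prod_insert (by simp)]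
      field_simp
  unfold prob
  rw [← mul_div_assoc, ← mul_div_assoc, key]

end PBD

end

/-!
Write `β_i` for the death rates, `π` for the equilibrium distribution, `F` for its distribution
function, `m` for its mean, and put `a i = F (i - 1) / (α π_{i-1})`,
`b i = (1 - F (i - 1)) / (α π_{i-1})`. These are `leftSol` and `rightSol`, whose index is shifted by
one: index `n` belongs to the state `i = n + 1`. By balance, `α a (i + 1) = β_i a i + 1` and
`α b (i + 1) = β_i b i - 1`. The sequence `a` is increasing and convex by induction, and `b` is
decreasing and convex by comparison from infinity (`nonneg_of_supersolution`).

For a fixed state `i` the Stein solution is `g k = -X b k - W a k` for `k = i, i + 1`, with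
`X = ∑_{j<i} (f i - f j) π_j` and `W = ∑_{j>i} (f j - f i) π_j`, and for `k = i + 2` the term
`Δ f i / α` is added. For Lipschitz `f` both `|X|` and `|W|` are largest for `f = id`. Let `h ≥ 0` be
the solution for `f = -id`. Then

* `|g i| ≤ h i`;
* `|Δ g i| ≤ h i`. This comes down to `W (a (i + 1) - 2 a i) ≤ X b (i + 1)` for `f = id`, which
  follows from `X ≥ F (i - 1)` and `(β_i - α) W ≤ β_i (1 - F i)`;
* `|Δ² g i| ≤ 2 / α + Δ² h i`, by convexity of `a` and `b`.

It remains to bound `h` and `Δ² h`. Put `u n = h (n + 1)`, and let `L` be minus the generator of the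
birth-death process and `c_n = β + 2 n`. Then `L u + c u = 1`, and if `x` satisfies
`L x + k c x = s`, its decrements `y n = x n - x (n + 1)` satisfy
`L y n + (k + 1) c_n y n = s n - s (n + 1) + 2 k x (n + 1)`. As `u` tends to `0`, the maximum
principle (`nonneg_of_killed_nonneg`), applied repeatedly, shows that `u` is nonnegative, decreasing
and convex with decreasing second differences. So `h` and `Δ² h` are largest in state `1`, where the
first two equations for `u` bound them. Since `h 1 = m / α`, Jensen's inequality in
`α = E (β X + X (X - 1))` (now `X` has law `π`) gives the bound with the square root. Both bounds on
`Δ g` are weaker than the corresponding bounds on `m / α`.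

For `β = 0` the state `0` is transient and `b 1` has no meaning, so `i = 1` is treated directly.
-/

noncomputable section

namespace PBD

open Filter Topology

/-! ### The equilibrium distribution and the Stein equation -/

theorem deathRate_zero (β : ℝ) : deathRate β 0 = 0 := by simp [deathRate]

theorem deathRate_succ (β : ℝ) (n : ℕ) : deathRate β (n + 1) = (n + 1) * (β + n) := by
  simp only [deathRate]; push_cast; ring

theorem deathRate_nonneg {β : ℝ} (hβ : 0 ≤ β) (n : ℕ) : 0 ≤ deathRate β n := by
  cases n with
  | zero => simp [deathRate]
  | succ n => rw [deathRate_succ]; positivity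

theorem add_natCast_pos {β : ℝ} (hβ : 0 ≤ β) {n : ℕ} (hn : firstState β ≤ n) : 0 < β + n := by
  rcases eq_or_lt_of_le hβ with h | h
  · subst h
    have : 1 ≤ n := by simpa [firstState] using hn
    have : (1 : ℝ) ≤ n := by exact_mod_cast this
    linarith
  · positivity

theorem deathRate_succ_pos {β : ℝ} (hβ : 0 ≤ β) {n : ℕ} (hn : firstState β ≤ n) :
    0 < deathRate β (n + 1) := by
  rw [deathRate_succ]
  have := add_natCast_pos hβ hn
  positivity

theorem weight_succ (α : ℝ) {β : ℝ} (hβ : 0 ≤ β) {n : ℕ} (hn : firstState β ≤ n) :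
    weight α β (n + 1) = weight α β n * (α / deathRate β (n + 1)) := by
  have h1 : ¬ n < firstState β := by omega
  have h2 : ¬ n + 1 < firstState β := by omega
  simp only [weight, h1, h2, if_false]
  rw [Finset.prod_Ico_succ_top hn, ← Finset.insert_Ioc_right_eq_Ioc_add_one hn,
    Finset.prod_insert (by simp)]
  have := (deathRate_succ_pos hβ hn).ne'
  rw [mul_comm (deathRate β (n + 1)), mul_div_mul_comm]

theorem weight_pos {α β : ℝ} (hα : 0 < α) (hβ : 0 ≤ β) {n : ℕ} (hn : firstState β ≤ n) :
    0 < weight α β n := by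
  induction n, hn using Nat.le_induction with
  | base => simp [weight]
  | succ n hn ih =>
    rw [weight_succ α hβ hn]
    have := deathRate_succ_pos hβ hn
    positivity

theorem weight_nonneg {α β : ℝ} (hα : 0 < α) (hβ : 0 ≤ β) (n : ℕ) : 0 ≤ weight α β n := by
  by_cases hn : n < firstState β
  · simp [weight, hn]
  · exact (weight_pos hα hβ (not_lt.mp hn)).le

theorem summable_weight {α β : ℝ} (hα : 0 < α) (hβ : 0 ≤ β) : Summable (weight α β) := by
  refine summable_of_ratio_test_tendsto_lt_one (l := 0) one_pos ?_ ?_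
  · filter_upwards [eventually_ge_atTop (firstState β)] with n hn
    exact (weight_pos hα hβ hn).ne'
  · have h0 : Tendsto (fun n : ℕ => α / (n : ℝ)) atTop (𝓝 0) :=
      tendsto_const_div_atTop_nhds_zero_nat α
    refine squeeze_zero' (Eventually.of_forall fun n => by positivity) ?_ h0
    filter_upwards [eventually_ge_atTop (firstState β), eventually_ge_atTop 1] with n hn hn1
    have hw := weight_pos hα hβ hn
    have hd := deathRate_succ_pos hβ hn
    have hn0 : (1 : ℝ) ≤ n := by exact_mod_cast hn1
    have h2 : ‖weight α β (n + 1)‖ / ‖weight α β n‖ = α / deathRate β (n + 1) := by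
      rw [weight_succ α hβ hn, norm_mul, Real.norm_of_nonneg hw.le,
        Real.norm_of_nonneg (div_pos hα hd).le]
      field_simp
    rw [h2]
    apply div_le_div_of_nonneg_left hα.le (by linarith)
    rw [deathRate_succ]
    nlinarith [mul_nonneg hβ (by linarith : (0 : ℝ) ≤ n)]

theorem tsum_weight_pos {α β : ℝ} (hα : 0 < α) (hβ : 0 ≤ β) : 0 < ∑' j, weight α β j :=
  (summable_weight hα hβ).tsum_pos (weight_nonneg hα hβ) (firstState β)
    (weight_pos hα hβ le_rfl)

theorem prob_nonneg {α β : ℝ} (hα : 0 < α) (hβ : 0 ≤ β) (n : ℕ) : 0 ≤ prob α β n :=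
  div_nonneg (weight_nonneg hα hβ n) (tsum_weight_pos hα hβ).le

theorem prob_pos {α β : ℝ} (hα : 0 < α) (hβ : 0 ≤ β) {n : ℕ} (hn : firstState β ≤ n) :
    0 < prob α β n :=
  div_pos (weight_pos hα hβ hn) (tsum_weight_pos hα hβ)

theorem hasSum_prob {α β : ℝ} (hα : 0 < α) (hβ : 0 ≤ β) : HasSum (prob α β) 1 := by
  have h := (summable_weight hα hβ).hasSum.div_const (∑' j, weight α β j)
  rwa [div_self (tsum_weight_pos hα hβ).ne'] at h

/-- The balance equations make `deathRate * prob` a shifted multiple of `prob`. -/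
theorem hasSum_deathRate_mul {α β : ℝ} (hβ : 0 ≤ β) {f : ℕ → ℝ} {s : ℝ}
    (h : HasSum (fun k => f (k + 1) * prob α β k) s) :
    HasSum (fun k => f k * (deathRate β k * prob α β k)) (α * s) := by
  have h1 : HasSum (fun k => f (k + 1) * (deathRate β (k + 1) * prob α β (k + 1))) (α * s) := by
    refine (h.mul_left α).congr_fun ?_
    intro k
    linear_combination -(f (k + 1)) * balance α hβ k
  have h2 := (hasSum_nat_add_iff (f := fun k => f k * (deathRate β k * prob α β k)) 1).mp h1
  simpa [deathRate_zero] using h2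

theorem summable_mul_prob {α β : ℝ} (hα : 0 < α) (hβ : 0 ≤ β) :
    Summable (fun k : ℕ => (k : ℝ) * prob α β k) := by
  have h1 : HasSum (fun k => 1 * prob α β k) 1 := by
    simpa only [one_mul] using hasSum_prob hα hβ
  have h2 : Summable (fun k => deathRate β k * prob α β k) := by
    simpa only [one_mul] using (hasSum_deathRate_mul (f := fun _ => 1) hβ h1).summable
  have h3 := (summable_nat_add_iff (f := fun k => deathRate β k * prob α β k) 2).mpr h2
  refine (summable_nat_add_iff (f := fun k : ℕ => (k : ℝ) * prob α β k) 2).mp ?_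
  refine Summable.of_nonneg_of_le (fun k => mul_nonneg (by positivity) (prob_nonneg hα hβ _))
    (fun k => ?_) h3
  refine mul_le_mul_of_nonneg_right ?_ (prob_nonneg hα hβ _)
  rw [deathRate_succ]
  push_cast
  have : (0 : ℝ) ≤ k := by positivity
  nlinarith

/-- The mean of `PBD(α; 0, β, 1)`. -/
def mean (α β : ℝ) : ℝ := ∑' k : ℕ, (k : ℝ) * prob α β k

theorem hasSum_mean {α β : ℝ} (hα : 0 < α) (hβ : 0 ≤ β) :
    HasSum (fun k : ℕ => (k : ℝ) * prob α β k) (mean α β) :=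
  (summable_mul_prob hα hβ).hasSum

theorem mean_nonneg {α β : ℝ} (hα : 0 < α) (hβ : 0 ≤ β) : 0 ≤ mean α β :=
  tsum_nonneg fun k => mul_nonneg (by positivity) (prob_nonneg hα hβ k)

theorem neg_mem_testFunctions {f : ℕ → ℝ} (hf : f ∈ testFunctions) : (fun k => -f k) ∈ testFunctions :=
  fun x y => by
    rw [show -f x - -f y = -(f x - f y) by ring, abs_neg]
    exact hf x y

theorem natCast_mem_testFunctions : (fun k : ℕ => (k : ℝ)) ∈ testFunctions := fun _ _ => le_rfl

theorem summable_abs_mul_prob {α β : ℝ} (hα : 0 < α) (hβ : 0 ≤ β) {f : ℕ → ℝ}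
    (hf : f ∈ testFunctions) : Summable (fun k : ℕ => |f k| * prob α β k) := by
  refine Summable.of_nonneg_of_le (fun k => mul_nonneg (abs_nonneg _) (prob_nonneg hα hβ _))
    (fun k => ?_) ((summable_mul_prob hα hβ).add ((hasSum_prob hα hβ).summable.mul_left |f 0|))
  rw [← add_mul]
  refine mul_le_mul_of_nonneg_right ?_ (prob_nonneg hα hβ _)
  have h1 := hf k 0
  have h2 : |f k| ≤ |f k - f 0| + |f 0| := by simpa using abs_add_le (f k - f 0) (f 0)
  have h3 : |(k : ℝ) - (0 : ℕ)| = k := by simp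
  linarith

theorem hasSum_integral {α β : ℝ} (hα : 0 < α) (hβ : 0 ≤ β) {f : ℕ → ℝ}
    (hf : f ∈ testFunctions) : HasSum (fun k => f k * prob α β k) (integral α β f) := by
  refine Summable.hasSum (Summable.of_norm ?_)
  refine (summable_abs_mul_prob hα hβ hf).congr fun k => ?_
  rw [norm_mul, Real.norm_eq_abs, Real.norm_of_nonneg (prob_nonneg hα hβ k)]

theorem existsUnique_isSteinSolution {α : ℝ} (hα : 0 < α) (β : ℝ) (f : ℕ → ℝ) :
    ∃! g : ℕ → ℝ, IsSteinSolution α β f g := by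
  let g : ℕ → ℝ := fun n => Nat.rec ((f 0 - integral α β f) / α)
    (fun n x => (deathRate β n * x + (f n - integral α β f)) / α) n
  have hg : ∀ n, g (n + 1) = (deathRate β n * g n + (f n - integral α β f)) / α := fun n => rfl
  have hg0 : g 0 = (f 0 - integral α β f) / α := rfl
  refine ⟨g, ⟨?_, fun i => ?_⟩, fun g' hg' => ?_⟩
  · rw [show g 1 = _ from hg 0, hg0, deathRate_zero, zero_mul, zero_add]
  · rw [hg]; field_simp; ring
  · funext n
    have h1 : ∀ n, g' (n + 1) = (deathRate β n * g' n + (f n - integral α β f)) / α := fun n => by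
      rw [eq_div_iff hα.ne']; linarith [hg'.2 n]
    induction n with
    | zero => rw [hg'.1, h1, hg0, deathRate_zero]; ring
    | succ n ih => rw [h1, hg, ih]

/-- Summed form of the Stein equation. -/
theorem IsSteinSolution.prob_mul {α β : ℝ} (hβ : 0 ≤ β) {f g : ℕ → ℝ}
    (h : IsSteinSolution α β f g) (n : ℕ) :
    α * prob α β n * g (n + 1) =
      ∑ j ∈ Finset.range (n + 1), (f j - integral α β f) * prob α β j := by
  induction n with
  | zero =>
    have := h.2 0
    rw [deathRate_zero] at this
    simp only [zero_add, Finset.range_one, Finset.sum_singleton]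
    linear_combination prob α β 0 * this
  | succ n ih =>
    rw [Finset.sum_range_succ, ← ih]
    linear_combination prob α β (n + 1) * h.2 (n + 1) - g (n + 1) * balance α hβ n

/-- Backward comparison for the homogeneous Stein equation: a supersolution that does not grow too
fast is nonnegative, because `prob * u` decreases to `0`. -/
theorem nonneg_of_supersolution {α β : ℝ} (hα : 0 < α) (hβ : 0 ≤ β) {N : ℕ}
    (hN : firstState β ≤ N) {u : ℕ → ℝ}
    (hu : ∀ n, N ≤ n → α * u (n + 1) ≤ deathRate β (n + 1) * u n)
    (hlim : Tendsto (fun n => prob α β n * u n) atTop (𝓝 0)) {n : ℕ} (hn : N ≤ n) : 0 ≤ u n := by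
  have hanti : ∀ k, n ≤ k → prob α β k * u k ≤ prob α β n * u n := by
    intro k hk
    induction k, hk using Nat.le_induction with
    | base => exact le_rfl
    | succ k hk ih =>
      refine le_trans ?_ ih
      have h1 := mul_le_mul_of_nonneg_left (hu k (hn.trans hk)) (prob_nonneg hα hβ (k + 1))
      have h2 := balance α hβ k
      have h3 : α * (prob α β (k + 1) * u (k + 1)) ≤ α * (prob α β k * u k) := by
        calc _ = prob α β (k + 1) * (α * u (k + 1)) := by ring
          _ ≤ _ := h1
          _ = _ := by linear_combination -(u k) * h2
      exact le_of_mul_le_mul_left h3 hα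
  have h0 : 0 ≤ prob α β n * u n :=
    le_of_tendsto hlim ((eventually_ge_atTop n).mono hanti)
  exact nonneg_of_mul_nonneg_right h0 (prob_pos hα hβ (hN.trans hn))

/-! ### Solutions built from the tails of the distribution -/

/-- `F (i - 1) / (α π_{i-1})` at `i = n + 1`, where `F` is the distribution function of
`PBD(α; 0, β, 1)`. It is defined through the recursion that it satisfies, which also gives a value in
the transient state `0` of the case `β = 0`. -/
def leftSol (α β : ℝ) : ℕ → ℝ
  | 0 => 1 / α
  | n + 1 => (deathRate β (n + 1) * leftSol α β n + 1) / α

theorem mul_leftSol_zero {α : ℝ} (hα : 0 < α) (β : ℝ) : α * leftSol α β 0 = 1 := by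
  rw [leftSol]; field_simp

theorem mul_leftSol_succ {α : ℝ} (hα : 0 < α) (β : ℝ) (n : ℕ) :
    α * leftSol α β (n + 1) = deathRate β (n + 1) * leftSol α β n + 1 := by
  rw [leftSol]; field_simp

theorem leftSol_pos {α β : ℝ} (hα : 0 < α) (hβ : 0 ≤ β) (n : ℕ) : 0 < leftSol α β n := by
  induction n with
  | zero => rw [leftSol]; positivity
  | succ n ih =>
    have := deathRate_nonneg hβ (n + 1)
    rw [leftSol]; positivity

theorem one_le_mul_leftSol {α β : ℝ} (hα : 0 < α) (hβ : 0 ≤ β) (n : ℕ) :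
    1 ≤ α * leftSol α β n := by
  cases n with
  | zero => rw [mul_leftSol_zero hα]
  | succ n =>
    rw [mul_leftSol_succ hα]
    have := mul_nonneg (deathRate_nonneg hβ (n + 1)) (leftSol_pos hα hβ n).le
    linarith

theorem leftSol_le_succ {α β : ℝ} (hα : 0 < α) (hβ : 0 ≤ β) (n : ℕ) :
    leftSol α β n ≤ leftSol α β (n + 1) := by
  refine le_of_mul_le_mul_left ?_ hα
  induction n with
  | zero =>
    rw [mul_leftSol_zero hα]
    exact one_le_mul_leftSol hα hβ 1
  | succ n ih =>
    have ih' := le_of_mul_le_mul_left ih hα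
    rw [mul_leftSol_succ hα, mul_leftSol_succ hα _ (n + 1)]
    have h1 : deathRate β (n + 1) ≤ deathRate β (n + 1 + 1) := by
      rw [deathRate_succ, deathRate_succ]; push_cast; nlinarith [(n.cast_nonneg : (0 : ℝ) ≤ n)]
    have := mul_le_mul h1 ih' (leftSol_pos hα hβ n).le (deathRate_nonneg hβ _)
    linarith

theorem leftSol_convex {α β : ℝ} (hα : 0 < α) (hβ : 0 ≤ β) (n : ℕ) :
    0 ≤ leftSol α β (n + 2) - 2 * leftSol α β (n + 1) + leftSol α β n := by
  refine nonneg_of_mul_nonneg_right (a := α) ?_ hα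
  induction n with
  | zero =>
    have h0 := mul_leftSol_zero hα β
    have h1 := mul_leftSol_succ hα β 0
    have h2 := mul_leftSol_succ hα β 1
    have p0 := leftSol_pos hα hβ 0
    have p1 := leftSol_pos hα hβ 1
    have h3 := leftSol_le_succ hα hβ 0
    rw [deathRate_succ] at h1 h2
    norm_num at h0 h1 h2 h3 ⊢
    nlinarith [mul_nonneg hβ (sub_nonneg.mpr h3)]
  | succ n ih =>
    have h1 := mul_leftSol_succ hα β n
    have h2 := mul_leftSol_succ hα β (n + 1)
    have h3 := mul_leftSol_succ hα β (n + 2)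
    have p0 := leftSol_pos hα hβ n
    have p1 := leftSol_pos hα hβ (n + 1)
    have d0 := leftSol_le_succ hα hβ n
    have d1 := leftSol_le_succ hα hβ (n + 1)
    have ih' := nonneg_of_mul_nonneg_right ih hα
    rw [deathRate_succ] at h1 h2 h3
    push_cast at h1 h2 h3
    have hn : (0 : ℝ) ≤ n := n.cast_nonneg
    have e : α * (leftSol α β (n + 1 + 2) - 2 * leftSol α β (n + 1 + 1) + leftSol α β (n + 1)) =
        (n + 1) * (β + n) * (leftSol α β (n + 2) - 2 * leftSol α β (n + 1) + leftSol α β n)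
        + (β + 2 * n + 2) * (leftSol α β (n + 1 + 1) - leftSol α β (n + 1))
        + (β + 2 * n + 4) * (leftSol α β (n + 1 + 1) - leftSol α β (n + 1))
        + 2 * leftSol α β (n + 1) := by
      linear_combination h3 - 2 * h2 + h1
    rw [e]
    have := sub_nonneg.mpr d0
    have := sub_nonneg.mpr d1
    positivity

theorem prob_mul_leftSol {α β : ℝ} (hα : 0 < α) (hβ : 0 ≤ β) (n : ℕ) :
    α * prob α β n * leftSol α β n = ∑ j ∈ Finset.range (n + 1), prob α β j := by
  induction n with
  | zero => simp only [zero_add, Finset.range_one, Finset.sum_singleton]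
            linear_combination prob α β 0 * mul_leftSol_zero hα β
  | succ n ih =>
    rw [Finset.sum_range_succ, ← ih]
    linear_combination prob α β (n + 1) * mul_leftSol_succ hα β n - leftSol α β n * balance α hβ n

/-- `(1 - F (i - 1)) / (α π_{i-1})` at `i = n + 1`, where `F` is the distribution function of
`PBD(α; 0, β, 1)`. The value is meaningful in recurrent states `n` only: elsewhere it is `0`. -/
def rightSol (α β : ℝ) (n : ℕ) : ℝ :=
  (1 - ∑ j ∈ Finset.range (n + 1), prob α β j) / (α * prob α β n)

theorem prob_mul_rightSol {α β : ℝ} (hα : 0 < α) (hβ : 0 ≤ β) {n : ℕ} (hn : firstState β ≤ n) :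
    α * prob α β n * rightSol α β n = 1 - ∑ j ∈ Finset.range (n + 1), prob α β j := by
  have := prob_pos hα hβ hn
  rw [rightSol]; field_simp

theorem rightSol_nonneg {α β : ℝ} (hα : 0 < α) (hβ : 0 ≤ β) (n : ℕ) : 0 ≤ rightSol α β n := by
  refine div_nonneg (sub_nonneg.mpr ?_) (mul_nonneg hα.le (prob_nonneg hα hβ n))
  exact sum_le_hasSum _ (fun k _ => prob_nonneg hα hβ k) (hasSum_prob hα hβ)

theorem mul_rightSol_succ {α β : ℝ} (hα : 0 < α) (hβ : 0 ≤ β) {n : ℕ} (hn : firstState β ≤ n) :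
    α * rightSol α β (n + 1) = deathRate β (n + 1) * rightSol α β n - 1 := by
  have h1 := prob_mul_rightSol hα hβ hn
  have h2 := prob_mul_rightSol hα hβ (Nat.le_succ_of_le hn)
  rw [Finset.sum_range_succ] at h2
  refine mul_left_cancel₀ (prob_pos hα hβ (Nat.le_succ_of_le hn)).ne' ?_
  linear_combination h2 - h1 + rightSol α β n * balance α hβ n

theorem one_le_mul_rightSol {α β : ℝ} (hα : 0 < α) (hβ : 0 ≤ β) {n : ℕ} (hn : firstState β ≤ n) :
    1 ≤ deathRate β (n + 1) * rightSol α β n := by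
  have h1 := mul_rightSol_succ hα hβ hn
  have h2 := mul_nonneg hα.le (rightSol_nonneg hα hβ (n + 1))
  linarith

theorem tendsto_prob_mul_rightSol {α β : ℝ} (hα : 0 < α) (hβ : 0 ≤ β) :
    Tendsto (fun n => prob α β n * rightSol α β n) atTop (𝓝 0) := by
  have h1 := ((hasSum_prob hα hβ).tendsto_sum_nat.comp (tendsto_add_atTop_nat 1)).const_sub 1
  have h2 := h1.div_const α
  simp only [sub_self, zero_div] at h2
  refine h2.congr' ?_
  filter_upwards [eventually_ge_atTop (firstState β)] with n hn
  have := prob_mul_rightSol hα hβ hn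
  rw [div_eq_iff hα.ne']
  simp only [Function.comp]
  linarith

theorem tendsto_prob {α β : ℝ} (hα : 0 < α) (hβ : 0 ≤ β) :
    Tendsto (prob α β) atTop (𝓝 0) := (hasSum_prob hα hβ).summable.tendsto_atTop_zero

theorem natCast_le_deathRate_succ {β : ℝ} (hβ : 0 ≤ β) (n : ℕ) : (n : ℝ) ≤ deathRate β (n + 1) := by
  rw [deathRate_succ]
  have hn : (0 : ℝ) ≤ n := n.cast_nonneg
  rcases n.eq_zero_or_pos with h | h
  · subst h; simpa using hβ
  · have : (1 : ℝ) ≤ n := by exact_mod_cast h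
    nlinarith

theorem eventually_rightSol_le_one {α β : ℝ} (hα : 0 < α) (hβ : 0 ≤ β) :
    ∀ᶠ n in atTop, rightSol α β n ≤ 1 := by
  obtain ⟨M, hM⟩ := exists_nat_ge (α + 1)
  have key : ∀ n, max M (firstState β) ≤ n → 0 ≤ 1 - rightSol α β n := by
    intro n hn
    refine nonneg_of_supersolution hα hβ (le_max_right M (firstState β)) (u := fun n =>
      1 - rightSol α β n) (fun k hk => ?_) ?_ hn
    · have h1 := mul_rightSol_succ hα hβ ((le_max_right _ _).trans hk)
      have h2 := natCast_le_deathRate_succ hβ k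
      have h3 : (M : ℝ) ≤ k := by exact_mod_cast (le_max_left _ _).trans hk
      linarith
    · simpa [mul_sub] using (tendsto_prob hα hβ).sub (tendsto_prob_mul_rightSol hα hβ)
  filter_upwards [eventually_ge_atTop (max M (firstState β))] with n hn
  linarith [key n hn]

theorem tendsto_prob_mul_rightSol_add {α β : ℝ} (hα : 0 < α) (hβ : 0 ≤ β) (k : ℕ) :
    Tendsto (fun n => prob α β n * rightSol α β (n + k)) atTop (𝓝 0) := by
  refine squeeze_zero' (Eventually.of_forall fun n =>
    mul_nonneg (prob_nonneg hα hβ n) (rightSol_nonneg hα hβ _)) ?_ (tendsto_prob hα hβ)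
  filter_upwards [(tendsto_add_atTop_nat k).eventually (eventually_rightSol_le_one hα hβ)] with n hn
  exact mul_le_of_le_one_right (prob_nonneg hα hβ n) hn

theorem rightSol_succ_le {α β : ℝ} (hα : 0 < α) (hβ : 0 ≤ β) {n : ℕ} (hn : firstState β ≤ n) :
    rightSol α β (n + 1) ≤ rightSol α β n := by
  refine sub_nonneg.mp (nonneg_of_supersolution hα hβ le_rfl (u := fun n =>
      rightSol α β n - rightSol α β (n + 1)) (fun k hk => ?_) ?_ hn)
  · have h1 := mul_rightSol_succ hα hβ hk
    have h2 := mul_rightSol_succ hα hβ (Nat.le_succ_of_le hk)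
    have h3 := rightSol_nonneg hα hβ (k + 1)
    rw [deathRate_succ] at h1 h2 ⊢
    push_cast at h2
    have h4 : 0 ≤ (β + 2 * k + 2) * rightSol α β (k + 1) := by positivity
    linear_combination h1 - h2 + h4
  · simpa [mul_sub] using (tendsto_prob_mul_rightSol_add hα hβ 0).sub
      (tendsto_prob_mul_rightSol_add hα hβ 1)

/-- `(n + 1) * rightSol n` is decreasing: this is the strengthening of `rightSol_succ_le` that makes
the comparison argument for convexity work. -/
theorem mul_rightSol_succ_le {α β : ℝ} (hα : 0 < α) (hβ : 0 ≤ β) {n : ℕ} (hn : firstState β ≤ n) :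
    (n + 2) * rightSol α β (n + 1) ≤ (n + 1) * rightSol α β n := by
  have key := nonneg_of_supersolution hα hβ le_rfl (u := fun n =>
      rightSol α β n - (n + 2) / (n + 1) * rightSol α β (n + 1)) (fun k hk => ?_) ?_ hn
  · have hn' : (0 : ℝ) < n + 1 := by positivity
    have e : (n + 1) * rightSol α β n - (n + 2) * rightSol α β (n + 1) =
        (n + 1) * (rightSol α β n - (n + 2) / (n + 1) * rightSol α β (n + 1)) := by field_simp
    have := mul_nonneg hn'.le key
    linarith
  · have h1 := mul_rightSol_succ hα hβ hk
    have h2 := mul_rightSol_succ hα hβ (Nat.le_succ_of_le hk)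
    have h3 := one_le_mul_rightSol hα hβ (Nat.le_succ_of_le hk)
    have h0 := rightSol_nonneg hα hβ (k + 1)
    rw [deathRate_succ] at h1 h2 h3 ⊢
    push_cast at h2 h3 ⊢
    have hk0 : (0 : ℝ) ≤ k := k.cast_nonneg
    have h4 : 0 ≤ (k + 2) * rightSol α β (k + 1) * (k + 2) := by positivity
    have e : (k + 1) * (β + k) * (rightSol α β k - (k + 2) / (k + 1) * rightSol α β (k + 1))
        - α * (rightSol α β (k + 1) - (k + 1 + 2) / (k + 1 + 1) * rightSol α β (k + 1 + 1)) =
        (((k + 1 + 1) * (β + (k + 1)) * rightSol α β (k + 1) - 1) +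
          (k + 2) * rightSol α β (k + 1) * (k + 2)) / (k + 2) := by
      have hk2 : (k : ℝ) + 2 ≠ 0 := by positivity
      have hk1 : (k : ℝ) + 1 ≠ 0 := by positivity
      have e1 : (k : ℝ) + 1 + 1 = k + 2 := by ring
      rw [e1] at h2 ⊢
      field_simp
      linear_combination (-(k + 2 : ℝ)) * h1 + (k + 3 : ℝ) * h2
    have h5 : 0 ≤ (((k + 1 + 1) * (β + (k + 1)) * rightSol α β (k + 1) - 1) +
          (k + 2) * rightSol α β (k + 1) * (k + 2)) / (k + 2) :=
      div_nonneg (by linarith) (by positivity)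
    linarith
  · have h1 := ((tendsto_prob_mul_rightSol_add hα hβ 1).mul
      (tendsto_one_div_add_atTop_nhds_zero_nat (𝕜 := ℝ)))
    have h2 := ((tendsto_prob_mul_rightSol_add hα hβ 0).sub
      (tendsto_prob_mul_rightSol_add hα hβ 1)).sub h1
    simp only [mul_zero, sub_zero] at h2
    refine h2.congr fun k => ?_
    have hk1 : (k : ℝ) + 1 ≠ 0 := by positivity
    simp only [add_zero]
    field_simp
    ring

theorem rightSol_convex {α β : ℝ} (hα : 0 < α) (hβ : 0 ≤ β) {n : ℕ} (hn : firstState β ≤ n) :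
    0 ≤ rightSol α β (n + 2) - 2 * rightSol α β (n + 1) + rightSol α β n := by
  refine nonneg_of_supersolution hα hβ le_rfl (u := fun n =>
      rightSol α β (n + 2) - 2 * rightSol α β (n + 1) + rightSol α β n) (fun k hk => ?_) ?_ hn
  · have h1 := mul_rightSol_succ hα hβ hk
    have h2 := mul_rightSol_succ hα hβ (Nat.le_succ_of_le hk)
    have h3 := mul_rightSol_succ hα hβ (Nat.le_add_right_of_le (k := 2) hk)
    have h4 := mul_rightSol_succ_le hα hβ (Nat.le_succ_of_le hk)
    have h5 := sub_nonneg.mpr (rightSol_succ_le hα hβ (Nat.le_succ_of_le hk))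
    rw [deathRate_succ] at h1 h2 h3 ⊢
    push_cast at h1 h2 h3 h4
    have hk0 : (0 : ℝ) ≤ k := k.cast_nonneg
    have h6 : 0 ≤ (β + k) * (rightSol α β (k + 1) - rightSol α β (k + 1 + 1)) := by positivity
    linear_combination h3 - 2 * h2 + h1 + 2 * h4 + 2 * h6
  · simpa [mul_sub, mul_add, mul_left_comm] using ((tendsto_prob_mul_rightSol_add hα hβ 2).sub
      ((tendsto_prob_mul_rightSol_add hα hβ 1).const_mul 2)).add
      (tendsto_prob_mul_rightSol_add hα hβ 0)

/-! ### Representation of Stein solutions -/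

/-- `∑_{j < i} (f i - f j) π_j` at `i = n + 1`: how far `f` stays below `f i` to the left of `i`. -/
def leftDev (α β : ℝ) (f : ℕ → ℝ) (n : ℕ) : ℝ :=
  ∑ j ∈ Finset.range (n + 1), (f (n + 1) - f j) * prob α β j

/-- `∑_{j ≥ i} (f j - f i) π_j` at `i = n + 1`: how far `f` rises above `f i` to the right of `i`. -/
def rightDev (α β : ℝ) (f : ℕ → ℝ) (n : ℕ) : ℝ :=
  ∑' j, (f (j + (n + 1)) - f (n + 1)) * prob α β (j + (n + 1))

theorem hasSum_sub_mul_prob {α β : ℝ} (hα : 0 < α) (hβ : 0 ≤ β) {f : ℕ → ℝ}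
    (hf : f ∈ testFunctions) (c : ℝ) :
    HasSum (fun k => (f k - c) * prob α β k) (integral α β f - c) := by
  simpa [sub_mul] using (hasSum_integral hα hβ hf).sub ((hasSum_prob hα hβ).mul_left c)

theorem hasSum_rightDev {α β : ℝ} (hα : 0 < α) (hβ : 0 ≤ β) {f : ℕ → ℝ}
    (hf : f ∈ testFunctions) (n : ℕ) :
    HasSum (fun j => (f (j + (n + 1)) - f (n + 1)) * prob α β (j + (n + 1)))
      (rightDev α β f n) :=
  ((summable_nat_add_iff (f := fun k => (f k - f (n + 1)) * prob α β k) (n + 1)).mpr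
    (hasSum_sub_mul_prob hα hβ hf _).summable).hasSum

theorem rightDev_sub_leftDev {α β : ℝ} (hα : 0 < α) (hβ : 0 ≤ β) {f : ℕ → ℝ}
    (hf : f ∈ testFunctions) (n : ℕ) :
    rightDev α β f n - leftDev α β f n = integral α β f - f (n + 1) := by
  have h := hasSum_sub_mul_prob hα hβ hf (f (n + 1))
  have h1 := h.summable.sum_add_tsum_nat_add (n + 1)
  rw [h.tsum_eq] at h1
  rw [← h1, rightDev, leftDev, sub_eq_neg_add, ← Finset.sum_neg_distrib]
  congr 1
  exact Finset.sum_congr rfl fun j _ => by ring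

theorem leftDev_neg (α β : ℝ) (f : ℕ → ℝ) (n : ℕ) :
    leftDev α β (fun k => -f k) n = -leftDev α β f n := by
  rw [leftDev, leftDev, ← Finset.sum_neg_distrib]
  exact Finset.sum_congr rfl fun j _ => by ring

theorem rightDev_neg (α β : ℝ) (f : ℕ → ℝ) (n : ℕ) :
    rightDev α β (fun k => -f k) n = -rightDev α β f n := by
  rw [rightDev, rightDev, ← tsum_neg]
  exact tsum_congr fun j => by ring

theorem abs_leftDev_le {α β : ℝ} (hα : 0 < α) (hβ : 0 ≤ β) {f : ℕ → ℝ}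
    (hf : f ∈ testFunctions) (n : ℕ) :
    |leftDev α β f n| ≤ leftDev α β (fun k => (k : ℝ)) n := by
  refine (Finset.abs_sum_le_sum_abs _ _).trans (Finset.sum_le_sum fun j hj => ?_)
  rw [abs_mul, abs_of_nonneg (prob_nonneg hα hβ j)]
  refine mul_le_mul_of_nonneg_right ((hf _ _).trans_eq (abs_of_nonneg ?_)) (prob_nonneg hα hβ j)
  have : (j : ℝ) ≤ (n + 1 : ℕ) := by exact_mod_cast (Finset.mem_range.mp hj).le
  linarith

theorem abs_rightDev_le {α β : ℝ} (hα : 0 < α) (hβ : 0 ≤ β) {f : ℕ → ℝ}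
    (hf : f ∈ testFunctions) (n : ℕ) :
    |rightDev α β f n| ≤ rightDev α β (fun k => (k : ℝ)) n := by
  have key : ∀ f ∈ testFunctions, rightDev α β f n ≤ rightDev α β (fun k => (k : ℝ)) n := by
    intro f hf
    refine hasSum_le (fun j => ?_) (hasSum_rightDev hα hβ hf n)
      (hasSum_rightDev hα hβ natCast_mem_testFunctions n)
    refine mul_le_mul_of_nonneg_right ?_ (prob_nonneg hα hβ _)
    refine (le_abs_self _).trans ((hf _ _).trans_eq (abs_of_nonneg ?_))
    push_cast
    have : (0 : ℝ) ≤ j := j.cast_nonneg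
    linarith
  refine abs_le'.mpr ⟨key f hf, ?_⟩
  rw [← rightDev_neg]
  exact key _ (neg_mem_testFunctions hf)

/-- The summed Stein equation in terms of the deviations of `f` from `f (n + 1)`. -/
theorem IsSteinSolution.apply_eq {α β : ℝ} (hα : 0 < α) (hβ : 0 ≤ β) {f g : ℕ → ℝ}
    (hf : f ∈ testFunctions) (hg : IsSteinSolution α β f g) {n : ℕ} (hn : firstState β ≤ n) :
    g (n + 1) = -leftDev α β f n * rightSol α β n - rightDev α β f n * leftSol α β n := by
  have h1 := hg.prob_mul hβ n
  have h2 := prob_mul_leftSol hα hβ n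
  have h3 := prob_mul_rightSol hα hβ hn
  have h4 := rightDev_sub_leftDev hα hβ hf n
  have h5 : ∑ j ∈ Finset.range (n + 1), (f j - integral α β f) * prob α β j =
      (f (n + 1) - integral α β f) * (∑ j ∈ Finset.range (n + 1), prob α β j) -
        leftDev α β f n := by
    rw [leftDev, Finset.mul_sum, ← Finset.sum_sub_distrib]
    exact Finset.sum_congr rfl fun j _ => by ring
  have hp := prob_pos hα hβ hn
  refine mul_left_cancel₀ (mul_pos hα hp).ne' ?_
  rw [h1, h5]
  linear_combination (∑ j ∈ Finset.range (n + 1), prob α β j) * h4 + leftDev α β f n * h3 +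
    rightDev α β f n * h2

/-- The representation one step later, with the same left and right deviations. -/
theorem IsSteinSolution.apply_succ_eq {α β : ℝ} (hα : 0 < α) (hβ : 0 ≤ β) {f g : ℕ → ℝ}
    (hf : f ∈ testFunctions) (hg : IsSteinSolution α β f g) {n : ℕ} (hn : firstState β ≤ n) :
    g (n + 2) =
      -leftDev α β f n * rightSol α β (n + 1) - rightDev α β f n * leftSol α β (n + 1) := by
  refine mul_left_cancel₀ hα.ne' ?_
  linear_combination hg.2 (n + 1) + deathRate β (n + 1) * hg.apply_eq hα hβ hf hn
    + rightDev α β f n * mul_leftSol_succ hα β n + leftDev α β f n * mul_rightSol_succ hα hβ hn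
    + rightDev_sub_leftDev hα hβ hf n

/-- The representation two steps later, with the same left and right deviations. -/
theorem IsSteinSolution.apply_add_two_eq {α β : ℝ} (hα : 0 < α) (hβ : 0 ≤ β) {f g : ℕ → ℝ}
    (hf : f ∈ testFunctions) (hg : IsSteinSolution α β f g) {n : ℕ} (hn : firstState β ≤ n) :
    g (n + 3) =
      -leftDev α β f n * rightSol α β (n + 2) - rightDev α β f n * leftSol α β (n + 2) +
        (f (n + 2) - f (n + 1)) / α := by
  refine mul_left_cancel₀ hα.ne' ?_
  have e : α * ((f (n + 2) - f (n + 1)) / α) = f (n + 2) - f (n + 1) := by field_simp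
  linear_combination hg.2 (n + 2) + deathRate β (n + 2) * hg.apply_succ_eq hα hβ hf hn
    + rightDev α β f n * mul_leftSol_succ hα β (n + 1)
    + leftDev α β f n * mul_rightSol_succ hα hβ (Nat.le_succ_of_le hn)
    + rightDev_sub_leftDev hα hβ hf n - e

theorem eq_zero_of_lt_firstState {β : ℝ} {n : ℕ} (hn : n < firstState β) : β = 0 ∧ n = 0 := by
  by_cases h : β = 0
  · exact ⟨h, by simpa [firstState, h] using hn⟩
  · simp [firstState, h] at hn

theorem prob_zero_zero (α : ℝ) : prob α 0 0 = 0 := by simp [prob, weight, firstState]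

theorem abs_sub_succ_le {f : ℕ → ℝ} (hf : f ∈ testFunctions) (n : ℕ) :
    |f (n + 1) - f n| ≤ 1 := by
  simpa using hf (n + 1) n

theorem integral_neg_natCast (α β : ℝ) : integral α β (fun k => -(k : ℝ)) = -mean α β := by
  simp [integral, mean, tsum_neg]

variable {α β : ℝ} {f g h : ℕ → ℝ}

/-- `f = -id` is extremal for the size of the solution. For `β = 0` this does not cover the state
`1`, which is the subject of `abs_apply_one_le`. -/
theorem IsSteinSolution.abs_apply_le (hα : 0 < α) (hβ : 0 ≤ β)
    (hf : f ∈ testFunctions) (hg : IsSteinSolution α β f g)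
    (hh : IsSteinSolution α β (fun k => -(k : ℝ)) h) {n : ℕ} (hn : firstState β ≤ n) :
    |g (n + 1)| ≤ h (n + 1) := by
  rw [hg.apply_eq hα hβ hf hn, hh.apply_eq hα hβ (neg_mem_testFunctions natCast_mem_testFunctions) hn,
    leftDev_neg, rightDev_neg]
  have h1 := abs_le.mp (abs_leftDev_le hα hβ hf n)
  have h2 := abs_le.mp (abs_rightDev_le hα hβ hf n)
  have h3 := rightSol_nonneg hα hβ n
  have h4 := (leftSol_pos hα hβ n).le
  rw [abs_le]
  constructor <;> nlinarith

theorem IsSteinSolution.abs_apply_one_le (hα : 0 < α) (hβ : 0 ≤ β)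
    (hf : f ∈ testFunctions) (hg : IsSteinSolution α β f g)
    (hh : IsSteinSolution α β (fun k => -(k : ℝ)) h) : |g 1| ≤ h 1 := by
  have h1 := hg.2 0
  have h2 := hh.2 0
  rw [integral_neg_natCast] at h2
  simp only [deathRate_zero, zero_mul, sub_zero, zero_add, Nat.cast_zero, neg_zero, zero_sub,
    neg_neg] at h1 h2
  have h3 : |integral α β f - f 0| ≤ mean α β := by
    have key : ∀ f ∈ testFunctions, integral α β f - f 0 ≤ mean α β := by
      intro f hf
      refine hasSum_le (fun k => ?_) (hasSum_sub_mul_prob hα hβ hf (f 0)) (hasSum_mean hα hβ)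
      refine mul_le_mul_of_nonneg_right ?_ (prob_nonneg hα hβ _)
      simpa using (le_abs_self _).trans (hf k 0)
    have k1 := key f hf
    have k2 := key _ (neg_mem_testFunctions hf)
    have k3 : integral α β (fun k => -f k) = -integral α β f := by
      simp [integral, tsum_neg]
    rw [k3] at k2
    exact abs_le'.mpr ⟨k1, by linarith⟩
  have h4 : |α * g 1| ≤ α * h 1 := by rw [h1, h2, abs_sub_comm]; exact h3
  rw [abs_mul, abs_of_pos hα] at h4
  exact le_of_mul_le_mul_left h4 hα

/-- With `i = n + 1`, the terms of `Δ² g i` that contain the deviations of `f` are together at most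
`Δ² h i + 1 / α`, their value for `f = -id`; the remaining term is `Δ f i / α`. -/
theorem IsSteinSolution.abs_second_diff_le (hα : 0 < α) (hβ : 0 ≤ β)
    (hf : f ∈ testFunctions) (hg : IsSteinSolution α β f g)
    (hh : IsSteinSolution α β (fun k => -(k : ℝ)) h) (n : ℕ) :
    |g (n + 3) - 2 * g (n + 2) + g (n + 1)| ≤
      2 / α + (h (n + 3) - 2 * h (n + 2) + h (n + 1)) := by
  have hid : (fun k : ℕ => -(k : ℝ)) ∈ testFunctions :=
    neg_mem_testFunctions natCast_mem_testFunctions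
  have w := abs_le.mp (abs_rightDev_le hα hβ hf n)
  have ca := leftSol_convex hα hβ n
  have sl : |(f (n + 2) - f (n + 1)) / α| ≤ 1 / α := by
    rw [abs_div, abs_of_pos hα]
    exact div_le_div_of_nonneg_right (abs_sub_succ_le hf _) hα.le
  have sl' := abs_le.mp sl
  by_cases hn : firstState β ≤ n
  · rw [hg.apply_eq hα hβ hf hn, hg.apply_succ_eq hα hβ hf hn, hg.apply_add_two_eq hα hβ hf hn,
      hh.apply_eq hα hβ hid hn, hh.apply_succ_eq hα hβ hid hn, hh.apply_add_two_eq hα hβ hid hn,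
      leftDev_neg, rightDev_neg]
    have x := abs_le.mp (abs_leftDev_le hα hβ hf n)
    have cr := rightSol_convex hα hβ hn
    have e1 : (-((n + 2 : ℕ) : ℝ) - -((n + 1 : ℕ) : ℝ)) / α = -(1 / α) := by push_cast; ring
    have e2 : 2 / α = 1 / α + 1 / α := by ring
    rw [e1, e2]
    have m1 := mul_le_mul_of_nonneg_right w.1 ca
    have m2 := mul_le_mul_of_nonneg_right w.2 ca
    have m3 := mul_le_mul_of_nonneg_right x.1 cr
    have m4 := mul_le_mul_of_nonneg_right x.2 cr
    rw [abs_le]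
    constructor <;> linarith
  · -- transient state: `β = 0` and `n = 0`, where `f 0` enters through `g 1` only
    obtain ⟨rfl, rfl⟩ := eq_zero_of_lt_firstState (not_le.mp hn)
    have rep : ∀ f ∈ testFunctions, ∀ g, IsSteinSolution α 0 f g →
        g 3 - 2 * g 2 + g 1 = -((f 1 - f 0) / α) + (f 2 - f 1) / α -
          rightDev α 0 f 0 * (leftSol α 0 2 - 2 * leftSol α 0 1 + leftSol α 0 0) := by
      intro f hf g hg
      have g0 := hg.2 0
      have g1 := hg.2 1
      have g2 := hg.2 2
      have a0 := mul_leftSol_zero hα 0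
      have a1 := mul_leftSol_succ hα 0 0
      have a2 := mul_leftSol_succ hα 0 1
      have d1 : deathRate 0 1 = 0 := by simp [deathRate]
      have d2 : deathRate 0 2 = 2 := by norm_num [deathRate]
      have hW := rightDev_sub_leftDev hα le_rfl hf 0
      have hX : leftDev α 0 f 0 = 0 := by simp [leftDev, prob_zero_zero]
      simp only [deathRate_zero, d1, d2, zero_add, Nat.reduceAdd, zero_mul, sub_zero, hX]
        at g0 g1 g2 a1 a2 hW
      have e1 : α * ((f 1 - f 0) / α) = f 1 - f 0 := by field_simp
      have e2 : α * ((f 2 - f 1) / α) = f 2 - f 1 := by field_simp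
      have e3 : α * (g 2 + rightDev α 0 f 0 * leftSol α 0 1) = 0 := by
        linear_combination g1 + rightDev α 0 f 0 * a1 + hW
      have e4 : g 2 = -(rightDev α 0 f 0 * leftSol α 0 1) := by
        have := (mul_eq_zero.mp e3).resolve_left hα.ne'
        linarith
      refine mul_left_cancel₀ hα.ne' ?_
      linear_combination g2 - 2 * g1 + g0 + 2 * e4 + e1 - e2 +
        rightDev α 0 f 0 * (a2 - 2 * a1 + a0)
    have r1 := rep f hf g hg
    have r2 := rep _ hid h hh
    rw [rightDev_neg] at r2
    norm_num at r1 r2 w ca sl' ⊢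
    rw [r1, r2]
    have sl2 : |(f 1 - f 0) / α| ≤ 1 / α := by
      rw [abs_div, abs_of_pos hα]
      exact div_le_div_of_nonneg_right (abs_sub_succ_le hf 0) hα.le
    have sl2' := abs_le.mp sl2
    have m1 := mul_le_mul_of_nonneg_right w.1 ca
    have m2 := mul_le_mul_of_nonneg_right w.2 ca
    have e2 : 2 / α = α⁻¹ + α⁻¹ := by ring
    have e3 : (1 : ℝ) / α = α⁻¹ := by ring
    have e4 : ((-2 + 1 : ℝ)) / α = -α⁻¹ := by ring
    rw [e3] at sl2'
    rw [abs_le]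
    constructor <;> (ring_nf at *; linarith)

/-! ### First differences, decay at infinity and a maximum principle -/

theorem deathRate_succ_le_deathRate_succ (hβ : 0 ≤ β) (n j : ℕ) :
    deathRate β (n + 1) ≤ deathRate β (j + n + 1 + 1) := by
  rw [deathRate_succ, deathRate_succ]
  push_cast
  have hn : (0 : ℝ) ≤ n := n.cast_nonneg
  have hj : (0 : ℝ) ≤ j := j.cast_nonneg
  exact mul_le_mul (by linarith) (by linarith) (by linarith) (by linarith)

/-- With `i = n + 1`, `(β_i - α) E (X - i)⁺ ≤ β_i P (X > i)`: by balance,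
`α E (X - i)⁺ = ∑_{j > i} (j - 1 - i) β_j π_j`, and `β_j ≥ β_i` here. -/
theorem sub_mul_rightDev_le (hα : 0 < α) (hβ : 0 ≤ β) (n : ℕ) :
    (deathRate β (n + 1) - α) * rightDev α β (fun k => (k : ℝ)) n ≤
      deathRate β (n + 1) * (1 - ∑ j ∈ Finset.range (n + 2), prob α β j) := by
  set y := rightDev α β (fun k => (k : ℝ)) n
  have h0 : HasSum (fun j : ℕ => (j : ℝ) * prob α β (j + (n + 1))) y := by
    convert hasSum_rightDev hα hβ natCast_mem_testFunctions n using 3 with j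
    push_cast; ring
  have h1 : HasSum (fun j : ℕ => ((j + 1 : ℕ) : ℝ) * prob α β (j + 1 + (n + 1))) y := by
    have := (hasSum_nat_add_iff' (f := fun j : ℕ => (j : ℝ) * prob α β (j + (n + 1))) 1).mpr h0
    simpa using this
  have h2 : HasSum (fun j => prob α β (j + (n + 2)))
      (1 - ∑ j ∈ Finset.range (n + 2), prob α β j) :=
    (hasSum_nat_add_iff' (n + 2)).mpr (hasSum_prob hα hβ)
  have h3 := hasSum_le (fun j => ?_) ((h1.sub h2).mul_left (deathRate β (n + 1))) (h0.mul_left α)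
  · linarith
  · have b := balance α hβ (j + (n + 1))
    rw [show j + (n + 2) = j + (n + 1) + 1 by ring, show j + 1 + (n + 1) = j + (n + 1) + 1 by ring]
    have p := prob_nonneg hα hβ (j + (n + 1) + 1)
    have m := mul_le_mul_of_nonneg_left (deathRate_succ_le_deathRate_succ hβ n j)
      (mul_nonneg (j.cast_nonneg : (0 : ℝ) ≤ j) p)
    push_cast
    calc _ = j * prob α β (j + (n + 1) + 1) * deathRate β (n + 1) := by ring
      _ ≤ j * prob α β (j + (n + 1) + 1) * deathRate β (j + (n + 1) + 1) := m
      _ = j * (deathRate β (j + (n + 1) + 1) * prob α β (j + (n + 1) + 1)) := by ring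
      _ = _ := by rw [← b]; ring

theorem sum_prob_le_leftDev (hα : 0 < α) (hβ : 0 ≤ β) (n : ℕ) :
    ∑ j ∈ Finset.range (n + 1), prob α β j ≤ leftDev α β (fun k => (k : ℝ)) n := by
  refine Finset.sum_le_sum fun j hj => le_mul_of_one_le_left (prob_nonneg hα hβ j) ?_
  have : ((j + 1 : ℕ) : ℝ) ≤ (n + 1 : ℕ) := by exact_mod_cast Finset.mem_range.mp hj
  push_cast at this ⊢
  linarith

/-- The first difference at `i = n + 1` is at most the size of the solution for `f = -id`
there. -/
theorem IsSteinSolution.abs_first_diff_le (hα : 0 < α) (hβ : 0 ≤ β)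
    (hf : f ∈ testFunctions) (hg : IsSteinSolution α β f g)
    (hh : IsSteinSolution α β (fun k => -(k : ℝ)) h) (n : ℕ) :
    |g (n + 2) - g (n + 1)| ≤ h (n + 1) := by
  by_cases hn : firstState β ≤ n
  · rw [hg.apply_eq hα hβ hf hn, hg.apply_succ_eq hα hβ hf hn,
      hh.apply_eq hα hβ (neg_mem_testFunctions natCast_mem_testFunctions) hn,
      leftDev_neg, rightDev_neg]
    have hX := abs_leftDev_le hα hβ hf n
    have hW := abs_rightDev_le hα hβ hf n
    set x := leftDev α β (fun k => (k : ℝ)) n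
    set y := rightDev α β (fun k => (k : ℝ)) n
    have hy : 0 ≤ y := (abs_nonneg _).trans hW
    have dr := sub_nonneg.mpr (rightSol_succ_le hα hβ hn)
    have dl := sub_nonneg.mpr (leftSol_le_succ hα hβ n)
    have hp := prob_pos hα hβ (Nat.le_succ_of_le hn)
    have pl := leftSol_pos hα hβ n
    have pr := rightSol_nonneg hα hβ (n + 1)
    -- with `i = n + 1`: bound `x` below by `F (i - 1)` and `(β_i - α) y` above by `β_i (1 - F i)`,
    -- and use `1 ≤ α * leftSol n`
    have key : y * (leftSol α β (n + 1) - 2 * leftSol α β n) ≤ x * rightSol α β (n + 1) := by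
      have s1 : α * prob α β n * leftSol α β n ≤ x :=
        (prob_mul_leftSol hα hβ n).trans_le (sum_prob_le_leftDev hα hβ n)
      have s2 := sub_mul_rightDev_le hα hβ n
      rw [← prob_mul_rightSol hα hβ (Nat.le_succ_of_le hn)] at s2
      have s3 := mul_leftSol_succ hα β n
      have s4 := one_le_mul_leftSol hα hβ n
      have s5 := mul_le_mul_of_nonneg_right s1 pr
      have s6 := mul_le_mul_of_nonneg_left s2 pl.le
      refine le_of_mul_le_mul_left ?_ hα
      have s7 := mul_le_mul_of_nonneg_left s4 hy
      have s8 := mul_le_mul_of_nonneg_left s5 hα.le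
      have b := balance α hβ n
      calc α * (y * (leftSol α β (n + 1) - 2 * leftSol α β n))
          = y * (α * leftSol α β (n + 1)) - 2 * (y * (α * leftSol α β n)) := by ring
        _ ≤ leftSol α β n * ((deathRate β (n + 1) - α) * y) := by rw [s3]; linarith
        _ ≤ _ := s6
        _ = α * (α * prob α β n * leftSol α β n * rightSol α β (n + 1)) := by
            linear_combination -(α * leftSol α β n * rightSol α β (n + 1)) * b
        _ ≤ _ := s8
    have e : -leftDev α β f n * rightSol α β (n + 1) - rightDev α β f n * leftSol α β (n + 1) -
        (-leftDev α β f n * rightSol α β n - rightDev α β f n * leftSol α β n) =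
        leftDev α β f n * (rightSol α β n - rightSol α β (n + 1)) -
          rightDev α β f n * (leftSol α β (n + 1) - leftSol α β n) := by ring
    rw [e]
    refine (abs_sub _ _).trans ?_
    rw [abs_mul, abs_mul, abs_of_nonneg dr, abs_of_nonneg dl]
    have m1 := mul_le_mul_of_nonneg_right hX dr
    have m2 := mul_le_mul_of_nonneg_right hW dl
    linarith
  · obtain ⟨rfl, rfl⟩ := eq_zero_of_lt_firstState (not_le.mp hn)
    have g0 := hg.2 0
    have g1 := hg.2 1
    have h0 := hh.2 0
    have d1 : deathRate 0 1 = 0 := by simp [deathRate]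
    rw [integral_neg_natCast] at h0
    simp only [deathRate_zero, d1, zero_mul, sub_zero, zero_add, Nat.reduceAdd, Nat.cast_zero,
      neg_zero, zero_sub, neg_neg] at g0 g1 h0 ⊢
    have hm : 1 ≤ mean α 0 := by
      refine hasSum_le (fun k => ?_) (hasSum_prob hα le_rfl) (hasSum_mean hα le_rfl)
      rcases k.eq_zero_or_pos with rfl | hk
      · simp [prob_zero_zero]
      · exact le_mul_of_one_le_left (prob_nonneg hα le_rfl k) (by exact_mod_cast hk)
    have e : α * (g 2 - g 1) = f 1 - f 0 := by linear_combination g1 - g0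
    have : α * |g 2 - g 1| ≤ α * h 1 := by
      rw [h0, ← abs_of_pos hα, ← abs_mul, abs_of_pos hα, e]
      exact (abs_sub_succ_le hf 0).trans hm
    exact le_of_mul_le_mul_left this hα

theorem IsSteinSolution.tendsto_prob_mul (hα : 0 < α) (hβ : 0 ≤ β)
    (hf : f ∈ testFunctions) (hg : IsSteinSolution α β f g) :
    Tendsto (fun n => prob α β n * g (n + 1)) atTop (𝓝 0) := by
  have h1 := ((hasSum_sub_mul_prob hα hβ hf (integral α β f)).tendsto_sum_nat.comp
    (tendsto_add_atTop_nat 1)).div_const α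
  rw [sub_self, zero_div] at h1
  refine h1.congr fun n => ?_
  rw [div_eq_iff hα.ne']
  simp only [Function.comp]
  rw [← hg.prob_mul hβ n]; ring

/-- The solution for `f = -id` vanishes at infinity, by comparison with `0` and `2 / i`. -/
theorem IsSteinSolution.tendsto_zero (hα : 0 < α) (hβ : 0 ≤ β)
    (hh : IsSteinSolution α β (fun k => -(k : ℝ)) h) :
    Tendsto (fun n => h (n + 1)) atTop (𝓝 0) := by
  have hm := mean_nonneg hα hβ
  have hlim := hh.tendsto_prob_mul hα hβ (neg_mem_testFunctions natCast_mem_testFunctions)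
  have hrec : ∀ n, α * h (n + 1 + 1) = deathRate β (n + 1) * h (n + 1) + mean α β - (n + 1) := by
    intro n
    have := hh.2 (n + 1)
    rw [integral_neg_natCast] at this
    push_cast at this
    linarith
  obtain ⟨M, hM⟩ := exists_nat_ge (max (2 * α + 1) (mean α β))
  have hM1 := (le_max_left _ _).trans hM
  have hM2 := (le_max_right _ _).trans hM
  have hlim2 := tendsto_one_div_add_atTop_nhds_zero_nat (𝕜 := ℝ)
  have lower : ∀ n, max M (firstState β) ≤ n → 0 ≤ h (n + 1) := fun n hn => by
    refine nonneg_of_supersolution hα hβ (le_max_right M (firstState β)) (u := fun n => h (n + 1))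
      (fun k hk => ?_) hlim hn
    have h1 := hrec k
    have h3 : (M : ℝ) ≤ k := by exact_mod_cast (le_max_left _ _).trans hk
    linarith
  have upper : ∀ n, max M (firstState β) ≤ n → 0 ≤ 2 * (1 / ((n : ℝ) + 1)) - h (n + 1) :=
    fun n hn => by
    refine nonneg_of_supersolution hα hβ (le_max_right M (firstState β))
      (u := fun n => 2 * (1 / ((n : ℝ) + 1)) - h (n + 1)) (fun k hk => ?_) ?_ hn
    · have h1 := hrec k
      have h3 : (M : ℝ) ≤ k := by exact_mod_cast (le_max_left _ _).trans hk
      have hk0 : (0 : ℝ) ≤ k := k.cast_nonneg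
      have e1 : deathRate β (k + 1) * (2 * (1 / ((k : ℝ) + 1))) = 2 * (β + k) := by
        rw [deathRate_succ]; field_simp
      have e2 : α * (2 * (1 / (((k + 1 : ℕ) : ℝ) + 1))) ≤ 2 * α := by
        have : 1 / (((k + 1 : ℕ) : ℝ) + 1) ≤ 1 := by
          rw [div_le_one (by positivity)]; push_cast; linarith
        nlinarith
      rw [mul_sub, mul_sub, e1]
      linarith
    · have := ((tendsto_prob hα hβ).mul (hlim2.const_mul 2)).sub hlim
      simpa [mul_sub] using this
  refine squeeze_zero' ?_ ?_ (by simpa only [mul_zero] using hlim2.const_mul 2)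
  · filter_upwards [eventually_ge_atTop (max M (firstState β))] with n hn using lower n hn
  · filter_upwards [eventually_ge_atTop (max M (firstState β))] with n hn
    linarith [upper n hn]

/-- Minus the generator of the birth-death process, applied to `x` in state `n`. The value of
`x (n - 1)` does not matter for `n = 0`. -/
def negGenerator (α β : ℝ) (x : ℕ → ℝ) (n : ℕ) : ℝ :=
  α * (x n - x (n + 1)) + deathRate β n * (x n - x (n - 1))

/-- Maximum principle for the process killed at rate `κ`. -/
theorem nonneg_of_killed_nonneg (hα : 0 < α) (hβ : 0 ≤ β) {x κ : ℕ → ℝ}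
    (hκ0 : 0 ≤ κ 0) (hκ : ∀ n, 0 < κ (n + 1))
    (hx : ∀ n, 0 ≤ negGenerator α β x n + κ n * x n)
    (hlim : Tendsto x atTop (𝓝 0)) (n : ℕ) : 0 ≤ x n := by
  by_contra! hneg
  obtain ⟨N, hN⟩ := eventually_atTop.mp (hlim.eventually (lt_mem_nhds hneg))
  obtain ⟨m, -, hm⟩ := Finset.exists_min_image (Finset.range (N + n + 1)) x ⟨0, by simp⟩
  have hmin : ∀ k, x m ≤ x k := by
    intro k
    by_cases hk : k < N + n + 1
    · exact hm k (Finset.mem_range.mpr hk)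
    · exact (hm n (Finset.mem_range.mpr (by omega))).trans (hN k (by omega)).le
  have no_min : ∀ m, (∀ k, x (m + 1) ≤ x k) → 0 ≤ x (m + 1) := by
    intro m hmin
    by_contra! hneg
    have h1 := hx (m + 1)
    rw [negGenerator] at h1
    have h2 := mul_nonneg hα.le (sub_nonneg.mpr (hmin (m + 1 + 1)))
    have h3 := mul_nonneg (deathRate_nonneg hβ (m + 1)) (sub_nonneg.mpr (hmin (m + 1 - 1)))
    have h4 := mul_pos (hκ m) (neg_pos.mpr hneg)
    linarith
  have hxm : x m < 0 := (hmin n).trans_lt hneg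
  cases m with
  | succ m => exact absurd (no_min m hmin) (not_le.mpr hxm)
  | zero =>
    -- the killing rate may vanish in `0`, but then `1` is a minimum as well
    have h1 := hx 0
    rw [negGenerator, deathRate_zero] at h1
    have h2 := mul_nonneg hκ0 (neg_nonneg.mpr hxm.le)
    have h3 : 0 ≤ x 0 - x 1 := nonneg_of_mul_nonneg_right (by linarith : 0 ≤ α * (x 0 - x 1)) hα
    have h4 := no_min 0 fun k => (sub_nonneg.mp h3).trans (hmin k)
    simp only [zero_add] at h4
    linarith

/-- Differencing raises the killing rate `k (β + 2 n)` to `(k + 1) (β + 2 n)` and adds the source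
`2 k x (n + 1)`, because death and killing rates increase with the state. -/
theorem negGenerator_sub_succ {x s : ℕ → ℝ} {k : ℝ}
    (hx : ∀ n : ℕ, negGenerator α β x n + k * (β + 2 * n) * x n = s n) (n : ℕ) :
    negGenerator α β (fun n => x n - x (n + 1)) n
        + (k + 1) * (β + 2 * n) * (x n - x (n + 1)) =
      s n - s (n + 1) + 2 * k * x (n + 1) := by
  have h1 := hx n
  have h2 := hx (n + 1)
  rw [negGenerator] at h1 h2 ⊢
  cases n with
  | zero =>
    rw [deathRate_succ] at h2
    simp only [deathRate_zero, zero_mul, add_zero, zero_add, Nat.cast_zero, mul_zero,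
      Nat.cast_one, Nat.reduceAdd] at h1 h2 ⊢
    linear_combination h1 - h2
  | succ n =>
    rw [deathRate_succ] at h1 h2 ⊢
    simp only [Nat.add_sub_cancel] at h1 h2 ⊢
    push_cast at h1 h2 ⊢
    linear_combination h1 - h2

/-! ### Monotonicity of the solution for `-id` and the numerical bounds -/

/-- The difference of two consecutive Stein equations for `f = -id`. The factor `1` makes it an
instance of the hypothesis of `negGenerator_sub_succ`. -/
theorem IsSteinSolution.killed_eq (hh : IsSteinSolution α β (fun k => -(k : ℝ)) h) (n : ℕ) :
    negGenerator α β (fun n => h (n + 1)) n + 1 * (β + 2 * n) * h (n + 1) = 1 := by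
  have h1 := hh.2 n
  have h2 := hh.2 (n + 1)
  rw [negGenerator]
  cases n with
  | zero =>
    rw [deathRate_succ] at h2
    simp only [deathRate_zero, zero_mul, add_zero, zero_add, Nat.cast_zero, mul_zero,
      Nat.cast_one, Nat.reduceAdd] at h1 h2 ⊢
    linear_combination h1 - h2
  | succ n =>
    rw [deathRate_succ] at h1 h2 ⊢
    simp only [Nat.add_sub_cancel] at h1 h2 ⊢
    push_cast at h1 h2 ⊢
    linear_combination h1 - h2

/-- The solution for `f = -id` is nonnegative, decreasing and convex, and its second differences
decrease (in fact it is completely monotone). -/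
theorem IsSteinSolution.monotonicity (hα : 0 < α) (hβ : 0 ≤ β)
    (hh : IsSteinSolution α β (fun k => -(k : ℝ)) h) :
    (∀ n, 0 ≤ h (n + 1)) ∧ (∀ n, h (n + 2) ≤ h (n + 1)) ∧
      (∀ n, 0 ≤ h (n + 3) - 2 * h (n + 2) + h (n + 1)) ∧
      ∀ n, h (n + 4) - 2 * h (n + 3) + h (n + 2) ≤ h (n + 3) - 2 * h (n + 2) + h (n + 1) := by
  have k0 : ∀ k : ℝ, 0 < k → 0 ≤ k * (β + 2 * (0 : ℕ)) := fun k hk => by positivity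
  have k1 : ∀ k : ℝ, 0 < k → ∀ n : ℕ, 0 < k * (β + 2 * (n + 1 : ℕ)) := fun k hk n => by positivity
  have shift : ∀ {x : ℕ → ℝ}, Tendsto x atTop (𝓝 0) →
      Tendsto (fun n => x n - x (n + 1)) atTop (𝓝 0) := fun {x} hx => by
    simpa using hx.sub ((tendsto_add_atTop_iff_nat 1).mpr hx)
  have l0 := hh.tendsto_zero hα hβ
  have l1 := shift l0
  have l2 := shift l1
  have l3 := shift l2
  have e0 := hh.killed_eq
  have e1 := negGenerator_sub_succ e0
  have p0 : ∀ n, 0 ≤ h (n + 1) := nonneg_of_killed_nonneg hα hβ (k0 1 one_pos) (k1 1 one_pos)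
    (fun n => by rw [e0]; exact zero_le_one) l0
  have e2 := negGenerator_sub_succ e1
  have p1 : ∀ n, 0 ≤ h (n + 1) - h (n + 1 + 1) :=
    nonneg_of_killed_nonneg hα hβ (k0 (1 + 1) (by norm_num)) (k1 (1 + 1) (by norm_num))
    (fun n => by rw [e1]; linarith [p0 (n + 1)]) l1
  have e3 := negGenerator_sub_succ e2
  have p2 : ∀ n, 0 ≤ h (n + 1) - h (n + 1 + 1) - (h (n + 1 + 1) - h (n + 1 + 1 + 1)) :=
    nonneg_of_killed_nonneg hα hβ (k0 (1 + 1 + 1) (by norm_num)) (k1 (1 + 1 + 1) (by norm_num))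
    (fun n => by rw [e2]; linarith [p1 (n + 1)]) l2
  have p3 := nonneg_of_killed_nonneg hα hβ (k0 (1 + 1 + 1 + 1) (by norm_num))
    (k1 (1 + 1 + 1 + 1) (by norm_num))
    (fun n => by rw [e3]; linarith [p2 (n + 1)]) l3
  refine ⟨p0, fun n => ?_, fun n => ?_, fun n => ?_⟩
  · linarith [p1 n]
  · linarith [p2 n]
  · linarith [p3 n]

theorem IsSteinSolution.mul_apply_one (hh : IsSteinSolution α β (fun k => -(k : ℝ)) h) :
    α * h 1 = mean α β := by
  have := hh.2 0
  rw [integral_neg_natCast] at this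
  simpa [deathRate_zero] using this

theorem IsSteinSolution.apply_le_apply_one (hα : 0 < α) (hβ : 0 ≤ β)
    (hh : IsSteinSolution α β (fun k => -(k : ℝ)) h) (n : ℕ) : h (n + 1) ≤ h 1 := by
  induction n with
  | zero => exact le_rfl
  | succ n ih => exact ((hh.monotonicity hα hβ).2.1 n).trans ih

theorem IsSteinSolution.second_diff_le (hα : 0 < α) (hβ : 0 ≤ β)
    (hh : IsSteinSolution α β (fun k => -(k : ℝ)) h) (n : ℕ) :
    h (n + 3) - 2 * h (n + 2) + h (n + 1) ≤ 1 / (α + β * (1 + β + α / 2)) := by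
  obtain ⟨-, h1, -, h3⟩ := hh.monotonicity hα hβ
  induction n with
  | succ n ih => exact (h3 n).trans ih
  | zero =>
    -- combine the equations in `0` and `1` with `h 3 ≤ h 2`
    have e0 := hh.killed_eq 0
    have e1 := hh.killed_eq 1
    have m1 := h1 1
    rw [negGenerator] at e0 e1
    rw [deathRate_succ] at e1
    norm_num [deathRate_zero] at e0 e1 m1 ⊢
    rw [← one_div, le_div_iff₀ (by positivity)]
    have m2 : 0 ≤ (h 2 - h 3) * (β ^ 2 + β + α) := mul_nonneg (by linarith) (by positivity)
    linear_combination m2 + (β / 2 + 1) * e0 - β / 2 * e1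

/-- The equations of `killed_eq` in `0` and `1`, closed by `h 3 ≤ h 2`. -/
theorem IsSteinSolution.apply_one_le (hα : 0 < α) (hβ : 0 ≤ β)
    (hh : IsSteinSolution α β (fun k => -(k : ℝ)) h) :
    h 1 ≤ 1 / (β + 2 * α / (α + 2 * β + 2)) := by
  obtain ⟨-, h1, -, -⟩ := hh.monotonicity hα hβ
  have e0 := hh.killed_eq 0
  have e1 := hh.killed_eq 1
  have m1 := h1 1
  rw [negGenerator] at e0 e1
  rw [deathRate_succ] at e1
  norm_num [deathRate_zero] at e0 e1 m1
  have e : β + 2 * α / (α + 2 * β + 2) =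
      ((2 * β + 2) * (α + β) - α * β) / (α + 2 * β + 2) := by field_simp; ring
  have hpos : 0 < (2 * β + 2) * (α + β) - α * β := by
    have : 0 < 2 * β * β + 2 * β + α * β + 2 * α := by positivity
    linarith
  rw [e, one_div_div, le_div_iff₀ hpos]
  have m2 : 0 ≤ α * α * (h 2 - h 3) := mul_nonneg (by positivity) (by linarith)
  linear_combination m2 + (2 * β + 2) * e0 + α * e1

/-- Jensen's inequality in `α = E (β X + X (X - 1))`. -/
theorem mean_sq_le (hα : 0 < α) (hβ : 0 ≤ β) :
    mean α β ^ 2 + (β - 1) * mean α β ≤ α := by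
  have h1 : HasSum (fun k => 1 * (deathRate β k * prob α β k)) (α * 1) :=
    hasSum_deathRate_mul (f := fun _ => 1) hβ (by simpa only [one_mul] using hasSum_prob hα hβ)
  have h2 := (h1.sub ((hasSum_mean hα hβ).mul_left (β - 1 + 2 * mean α β))).add
    ((hasSum_prob hα hβ).mul_left (mean α β ^ 2))
  have h3 := h2.nonneg fun k => by
    rw [show 1 * (deathRate β k * prob α β k) - (β - 1 + 2 * mean α β) * (k * prob α β k) +
      mean α β ^ 2 * prob α β k = (k - mean α β) ^ 2 * prob α β k by rw [deathRate]; ring]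
    exact mul_nonneg (sq_nonneg _) (prob_nonneg hα hβ k)
  linarith

theorem mean_le (hα : 0 < α) (hβ : 0 ≤ β) :
    mean α β ≤ √(α + (1 - β) ^ 2 / 4) + (1 - β) / 2 := by
  have h1 := mean_sq_le hα hβ
  have h2 : mean α β - (1 - β) / 2 ≤ √(α + (1 - β) ^ 2 / 4) :=
    Real.le_sqrt_of_sq_le (by linarith)
  linarith

theorem one_div_le_first_diff_bound (hα : 0 < α) (hβ : 0 ≤ β) :
    1 / (β + 2 * α / (α + 2 * β + 2)) ≤
      1 / (β + 1) + (α + 2) / (α * (α + 2) + 2 * β * (α + β + 1)) := by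
  have e : β + 2 * α / (α + 2 * β + 2) =
      (2 * β * (β + 1) + α * (β + 2)) / (α + 2 * β + 2) := by field_simp; ring
  rw [e, one_div_div, div_add_div _ _ (by positivity) (by positivity),
    div_le_div_iff₀ (by positivity) (by positivity), ← sub_nonneg]
  have : 0 ≤ α * (α + 2 * β + 2) * (β ^ 2 + β + α) := by positivity
  linear_combination this

theorem sqrt_bound_le_first_diff_bound (hα : 0 < α) (hβ : 0 ≤ β) :
    (√(α + (1 - β) ^ 2 / 4) + (1 - β) / 2) / α ≤ 1 / √α + 1 / α := by
  have e : 1 / √α + 1 / α = (√α + 1) / α := by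
    rw [add_div, Real.sqrt_div_self']
  rw [e]
  refine div_le_div_of_nonneg_right ?_ hα.le
  have h1 : √(α + (1 - β) ^ 2 / 4) ≤ √α + |(1 - β) / 2| := by
    rw [show (1 - β) ^ 2 / 4 = |(1 - β) / 2| ^ 2 by rw [sq_abs]; ring]
    refine Real.sqrt_le_iff.mpr ⟨by positivity, ?_⟩
    have := mul_nonneg (Real.sqrt_nonneg α) (abs_nonneg ((1 - β) / 2))
    nlinarith [Real.sq_sqrt hα.le]
  have h2 : |(1 - β) / 2| + (1 - β) / 2 ≤ 1 := by
    rcases abs_cases ((1 - β) / 2) with ⟨h, -⟩ | ⟨h, -⟩ <;> rw [h] <;> linarith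
  linarith

theorem supNorm_le_ofReal {g : ℕ → ℝ} {B : ℝ} (h : ∀ i, |g i| ≤ B) :
    supNorm g ≤ ENNReal.ofReal B :=
  iSup_le fun i => by
    rw [Real.enorm_eq_ofReal_abs]
    exact ENNReal.ofReal_le_ofReal (h i)

end PBD

end

theorem theorem1 (α β : ℝ) (hα : 0 < α) (hβ : 0 ≤ β) :
    -- `PBD(α; 0, β, 1)` is a probability distribution with a finite mean
    (∀ k, 0 ≤ PBD.prob α β k) ∧ HasSum (PBD.prob α β) 1 ∧
    Summable (fun k : ℕ => (k : ℝ) * PBD.prob α β k) ∧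
    -- every test function is integrable, and its Stein equation has exactly one solution
    (∀ f ∈ PBD.testFunctions, Summable (fun k : ℕ => |f k| * PBD.prob α β k) ∧
      ∃! g : ℕ → ℝ, PBD.IsSteinSolution α β f g) ∧
    ∀ g : (ℕ → ℝ) → ℕ → ℝ, (∀ f ∈ PBD.testFunctions, PBD.IsSteinSolution α β f (g f)) →
      -- the solutions
      ((⨆ f ∈ PBD.testFunctions, PBD.supNorm (g f)) =
          ENNReal.ofReal (1 / α * ∑' k : ℕ, (k : ℝ) * PBD.prob α β k) ∧
        1 / α * ∑' k : ℕ, (k : ℝ) * PBD.prob α β k ≤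
          min (1 / (β + 2 * α / (α + 2 * β + 2)))
            ((√(α + (1 - β) ^ 2 / 4) + (1 - β) / 2) / α)) ∧
      -- their first differences
      (⨆ f ∈ PBD.testFunctions, PBD.supNorm (fwdDiff 1 (g f))) ≤
        ENNReal.ofReal
          (min (1 / (β + 1) + (α + 2) / (α * (α + 2) + 2 * β * (α + β + 1)))
            (1 / √α + 1 / α)) ∧
      -- their second differences
      ((⨆ f ∈ PBD.testFunctions, PBD.supNorm (fwdDiff 1 (fwdDiff 1 (g f)))) ≤
          ENNReal.ofReal (2 / α + 1 / (α + β * (1 + β + α / 2))) ∧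
        2 / α + 1 / (α + β * (1 + β + α / 2)) ≤ 3 / α) := by
  refine ⟨PBD.prob_nonneg hα hβ, PBD.hasSum_prob hα hβ, PBD.summable_mul_prob hα hβ,
    fun f hf => ⟨PBD.summable_abs_mul_prob hα hβ hf, PBD.existsUnique_isSteinSolution hα β f⟩,
    fun g hg => ?_⟩
  have hid := PBD.neg_mem_testFunctions PBD.natCast_mem_testFunctions
  obtain ⟨h, hh⟩ : ∃ h, h = g fun k => -(k : ℝ) := ⟨_, rfl⟩
  have hS : PBD.IsSteinSolution α β (fun k => -(k : ℝ)) h := hh ▸ hg _ hid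
  obtain ⟨h0, hanti, -, -⟩ := hS.monotonicity hα hβ
  have hmean : 1 / α * ∑' k : ℕ, (k : ℝ) * PBD.prob α β k = h 1 := by
    have := hS.mul_apply_one
    rw [PBD.mean] at this
    rw [← this]; field_simp
  have hB1 := hS.apply_one_le hα hβ
  have hB2 : h 1 ≤ (√(α + (1 - β) ^ 2 / 4) + (1 - β) / 2) / α := by
    rw [le_div_iff₀ hα, mul_comm, hS.mul_apply_one]
    exact PBD.mean_le hα hβ
  have hbound : ∀ f ∈ PBD.testFunctions, ∀ i, |g f i| ≤ h 1 := by
    intro f hf i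
    have h1 := (hg f hf).abs_apply_one_le hα hβ hf hS
    rcases i with _ | i
    · rwa [(hg f hf).1]
    · by_cases hi : PBD.firstState β ≤ i
      · exact ((hg f hf).abs_apply_le hα hβ hf hS hi).trans (hS.apply_le_apply_one hα hβ i)
      · obtain ⟨-, rfl⟩ := PBD.eq_zero_of_lt_firstState (not_le.mp hi)
        exact h1
  have hD : ∀ f ∈ PBD.testFunctions, ∀ i, |g f (i + 2) - g f (i + 1)| ≤ h 1 := fun f hf i =>
    ((hg f hf).abs_first_diff_le hα hβ hf hS i).trans (hS.apply_le_apply_one hα hβ i)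
  have hQ : (0 : ℝ) < 1 / (α + β * (1 + β + α / 2)) := by positivity
  refine ⟨⟨?_, ?_⟩, ?_, ?_, ?_⟩
  · rw [hmean]
    refine le_antisymm (iSup₂_le fun f hf => PBD.supNorm_le_ofReal (hbound f hf)) ?_
    refine le_trans ?_ (le_iSup₂ (f := fun f (_ : f ∈ PBD.testFunctions) => PBD.supNorm (g f))
      (fun k => -(k : ℝ)) hid)
    refine le_trans ?_ (le_iSup (fun i => ‖g (fun k => -(k : ℝ)) i‖ₑ) 1)
    rw [← hh, Real.enorm_eq_ofReal_abs, abs_of_nonneg (h0 0)]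
  · rw [hmean]
    exact le_min hB1 hB2
  · refine iSup₂_le fun f hf => PBD.supNorm_le_ofReal fun i => ?_
    refine le_trans ?_ (le_min (hB1.trans (PBD.one_div_le_first_diff_bound hα hβ))
      (hB2.trans (PBD.sqrt_bound_le_first_diff_bound hα hβ)))
    rcases i with _ | i
    · simpa [fwdDiff, (hg f hf).1] using h0 0
    · exact hD f hf i
  · refine iSup₂_le fun f hf => PBD.supNorm_le_ofReal fun i => ?_
    rcases i with _ | i
    · -- `Δ² g 0 = Δ g 1` by the convention `g 0 = g 1`, and `α Δ g 1 = β g 1 + f 1 - f 0`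
      have e : α * (g f 2 - g f 1) = β * g f 1 + (f 1 - f 0) := by
        have g0 := (hg f hf).2 0
        have g1 := (hg f hf).2 1
        norm_num [PBD.deathRate] at g0 g1
        linear_combination g1 - g0
      have k0 := hS.killed_eq 0
      have m := hanti 0
      norm_num [PBD.negGenerator, PBD.deathRate_zero] at k0 m
      have k1 : α * |g f 2 - g f 1| ≤ 2 := by
        rw [← abs_of_pos hα, ← abs_mul, e]
        refine (abs_add_le _ _).trans ?_
        have a1 := PBD.abs_sub_succ_le hf 0
        have a2 : |β * g f 1| ≤ β * h 1 := by
          rw [abs_mul, abs_of_nonneg hβ]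
          exact mul_le_mul_of_nonneg_left (hbound f hf 1) hβ
        have a3 := mul_nonneg hα.le (sub_nonneg.mpr m)
        linarith
      have k2 : |g f 2 - g f 1| ≤ 2 / α := by rw [le_div_iff₀ hα]; linarith
      have k3 : fwdDiff 1 (fwdDiff 1 (g f)) 0 = g f 2 - g f 1 := by
        simp [fwdDiff, (hg f hf).1]
      rw [k3]
      linarith
    · have k := (hg f hf).abs_second_diff_le hα hβ hf hS i
      have k' := hS.second_diff_le hα hβ i
      have k3 : fwdDiff 1 (fwdDiff 1 (g f)) (i + 1) =
          g f (i + 3) - 2 * g f (i + 2) + g f (i + 1) := by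
        simp only [fwdDiff, add_assoc, Nat.reduceAdd]; ring
      rw [k3]
      linarith
  · have : 1 / (α + β * (1 + β + α / 2)) ≤ 1 / α :=
      one_div_le_one_div_of_le hα (le_add_of_nonneg_right (by positivity))
    calc _ ≤ 2 / α + 1 / α := by linarith
      _ = 3 / α := by ring
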